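/- Lemma (restricted infinity norm bound for Gaussian matrices). For every $\kappa>0$ there is a constant $C=C(\kappa)>0$, depending on $\kappa$ only, such that the following holds. Let $m,p\ge 1$ and $s\ge 0$ be integers, let $0<\varepsilon<1$ be such that $\log(p/\varepsilon)\le \kappa m$, and let $H$ be a random $m\times p$ matrix with i.i.d. $N(0,1/m)$ entries. Then, with $$\delta = C s\sqrt{\frac{\log(p/\varepsilon)}{m}},$$ with probability at least $1-\varepsilon$ the inequality $$\|(I-H^TH)x\|_\infty\le\delta\,\|x\|_\infty$$ holds simultaneously for all $s$-sparse $x\in\mathbb{R}^p$ (vectors with at most $s$ nonzero entries). (In particular, taking $\kappa=1$, the constant $C$ is absolute in the regime $m\ge\log(p/\varepsilon)$.) -/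

import Mathlib

open MeasureTheory ProbabilityTheory
open scoped Matrix

/-- The vector `x` has at most `s` nonzero entries. -/
def IsSparse {p : ℕ} (s : ℕ) (x : Fin p → ℝ) : Prop :=
  (Finset.univ.filter fun j => x j ≠ 0).card ≤ s

/-- `H` is a random `m × p` matrix whose entries are independent, each with law `N(0, 1/m)`
(mean `0`, variance `1/m`). -/
structure IsGaussianMatrix {Ω : Type*} [MeasurableSpace Ω] (μ : Measure Ω) {m p : ℕ}
    (H : Ω → Matrix (Fin m) (Fin p) ℝ) : Prop where
  hasLaw : ∀ i j, HasLaw (fun ω => H ω i j) (gaussianReal 0 (1 / (m : NNReal))) μ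
  indep : iIndepFun (fun (ij : Fin m × Fin p) ω => H ω ij.1 ij.2) μ

/-!
Write `ℓ = log (p / ε)` and `δ₀ = C * √(ℓ / m)`. If every entry of `1 - HᵀH` is at most `δ₀` in
absolute value, then each coordinate of `(1 - HᵀH) x` is a sum of at most `s` nonzero terms of size
at most `δ₀ * ‖x‖` (`norm_mulVec_le_of_isSparse`), so an entrywise bound is enough.

By polarization (`abs_one_sub_transpose_mul_self_le`) the entries of `HᵀH` are expressed through the
`p ^ 2` sums of squares `∑ i, (H i j) ^ 2` and `∑ i, ((H i j ± H i k) / √2) ^ 2`. In each of them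
the summands are squares of independent `N(0, 1/m)` variables, so all have the same law, the Gamma
law with shape and rate `m / 2` (`hasLaw_sum_sq_gammaMeasure`, by comparison of moment-generating
functions). The Chernoff bound for this law (`gammaMeasure_abs_sub_one_gt_le`) shows that each sum
deviates from `1` by more than `δ₀` with probability at most `2 * exp (-4 * ℓ) = 2 * (ε / p) ^ 4`;
here `ℓ ≤ κ * m` keeps the deviation in the Gaussian range. When `ε / p ≤ 1 / 2`, the union bound
over `p ^ 2` events gives the claim.

The remaining case is `p = 1` and `ε > 1 / 2`. As `ε → 1` the deviation allowed is much smaller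
than the standard deviation, and tail bounds say nothing; instead the Gamma law has to charge small
neighbourhoods of `1`, uniformly in `m`. In the coordinate `y = log x` its density is proportional
to `exp (-(m / 2) * (exp y - y))`, which is unimodal with mode `0`, so the mass of `[-b, b]` is at
least `b / B` times that of `[-B, B]` (`div_mul_gammaMeasure_Icc_exp_le`). For `B = 8 / √m` the
latter is at least `1 / 2` by the Chernoff bound. This gives a lower bound of order `√ℓ`, which
dominates `1 - ε ≤ ℓ` (`one_sub_le_gammaMeasure_abs_sub_one_le`).
-/

/-! ### Exponential moments of the Gamma law -/

/-- Exponential tilting turns the Gamma density of rate `r` into the one of rate `r - t`. -/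
lemma exp_mul_gammaPDFReal {a r t : ℝ} (hr : 0 < r) (ht : t < r) (x : ℝ) :
    Real.exp (t * x) * gammaPDFReal a r x = (r / (r - t)) ^ a * gammaPDFReal a (r - t) x := by
  unfold gammaPDFReal
  have h : 0 < r - t := sub_pos.2 ht
  split_ifs with hx
  · rw [Real.div_rpow hr.le h.le, show -((r - t) * x) = t * x + -(r * x) by ring, Real.exp_add]
    have := (Real.rpow_pos_of_pos h a).ne'
    field_simp
  · simp

lemma integrable_gammaPDFReal {a r : ℝ} (ha : 0 < a) (hr : 0 < r) :
    Integrable (gammaPDFReal a r) := by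
  refine ⟨(measurable_gammaPDFReal a r).aestronglyMeasurable, ?_⟩
  rw [hasFiniteIntegral_iff_ofReal (ae_of_all _ fun x => gammaPDFReal_nonneg ha hr x)]
  exact (lintegral_gammaPDF_eq_one ha hr).trans_lt ENNReal.one_lt_top

lemma integral_gammaPDFReal {a r : ℝ} (ha : 0 < a) (hr : 0 < r) :
    ∫ x, gammaPDFReal a r x = 1 := by
  rw [integral_eq_lintegral_of_nonneg_ae (ae_of_all _ fun x => gammaPDFReal_nonneg ha hr x)
    (measurable_gammaPDFReal a r).aestronglyMeasurable]
  exact congrArg ENNReal.toReal (lintegral_gammaPDF_eq_one ha hr)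

lemma measurable_gammaPDF (a r : ℝ) : Measurable (gammaPDF a r) :=
  (measurable_gammaPDFReal a r).ennreal_ofReal

lemma integral_gammaMeasure {a r : ℝ} (ha : 0 < a) (hr : 0 < r) (f : ℝ → ℝ) :
    ∫ x, f x ∂gammaMeasure a r = ∫ x, f x * gammaPDFReal a r x := by
  rw [gammaMeasure, integral_withDensity_eq_integral_toReal_smul (measurable_gammaPDF a r)
    (ae_of_all _ fun _ => ENNReal.ofReal_lt_top)]
  refine integral_congr_ae (ae_of_all _ fun x => ?_)
  simp [gammaPDF, ENNReal.toReal_ofReal (gammaPDFReal_nonneg ha hr x), mul_comm]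

lemma integrable_gammaMeasure_iff {a r : ℝ} (ha : 0 < a) (hr : 0 < r) (f : ℝ → ℝ) :
    Integrable f (gammaMeasure a r) ↔ Integrable fun x => f x * gammaPDFReal a r x := by
  rw [gammaMeasure, integrable_withDensity_iff (measurable_gammaPDF a r)
    (ae_of_all _ fun _ => ENNReal.ofReal_lt_top)]
  simp only [gammaPDF, ENNReal.toReal_ofReal (gammaPDFReal_nonneg ha hr _)]

lemma integrable_exp_mul_gammaMeasure {a r t : ℝ} (ha : 0 < a) (hr : 0 < r) (ht : t < r) :
    Integrable (fun x => Real.exp (t * x)) (gammaMeasure a r) := by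
  rw [integrable_gammaMeasure_iff ha hr]
  simp only [exp_mul_gammaPDFReal hr ht]
  exact (integrable_gammaPDFReal ha (sub_pos.2 ht)).const_mul _

lemma mgf_gammaMeasure {a r t : ℝ} (ha : 0 < a) (hr : 0 < r) (ht : t < r) :
    mgf id (gammaMeasure a r) t = (r / (r - t)) ^ a := by
  simp only [mgf, id, integral_gammaMeasure ha hr, exp_mul_gammaPDFReal hr ht]
  rw [integral_const_mul, integral_gammaPDFReal ha (sub_pos.2 ht), mul_one]

/-- Beyond the rate `r` the exponential moment diverges, because `x ^ (a - 1)` is not integrable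
on the half-line; the junk value of the integral is then `0`. -/
lemma mgf_gammaMeasure_of_le {a r t : ℝ} (ha : 0 < a) (hr : 0 < r) (ht : r ≤ t) :
    mgf id (gammaMeasure a r) t = 0 := by
  refine integral_undef fun h => ?_
  simp only [id] at h
  rw [integrable_gammaMeasure_iff ha hr] at h
  refine not_integrableOn_Ioi_rpow (a - 1) ?_
  have hc : 0 < r ^ a / Real.Gamma a := by have := Real.Gamma_pos_of_pos ha; positivity
  refine Integrable.mono' ((h.const_mul (r ^ a / Real.Gamma a)⁻¹).integrableOn
    (s := Set.Ioi (0 : ℝ))) (by fun_prop) ?_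
  filter_upwards [ae_restrict_mem measurableSet_Ioi] with x hx
  have hx : 0 < x := hx
  rw [Real.norm_of_nonneg (by positivity), gammaPDFReal, if_pos hx.le]
  have h1 : 1 ≤ Real.exp (t * x) * Real.exp (-(r * x)) := by
    rw [← Real.exp_add]; exact Real.one_le_exp (by nlinarith)
  calc x ^ (a - 1) ≤ x ^ (a - 1) * (Real.exp (t * x) * Real.exp (-(r * x))) :=
        le_mul_of_one_le_right (by positivity) h1
    _ = _ := by field_simp

/-! ### The law of a sum of Gaussian squares -/

/-- The identity holds for all `t`: where the exponential moment diverges both sides are `0`. -/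
lemma mgf_sq_gaussianReal {v : NNReal} (hv : v ≠ 0) (t : ℝ) :
    mgf (fun x => x ^ 2) (gaussianReal 0 v) t =
      (√(2 * Real.pi * v))⁻¹ * √(Real.pi / ((2 * (v : ℝ))⁻¹ - t)) := by
  rw [mgf, integral_gaussianReal_eq_integral_smul hv, ← integral_gaussian, ← integral_const_mul]
  refine integral_congr_ae (ae_of_all _ fun x => ?_)
  simp only [gaussianPDFReal, smul_eq_mul, mul_assoc, ← Real.exp_add]
  congr 3
  ring

/-- A moment-generating function that is finite near `0` determines the law: it extends to a
vertical strip, which contains the imaginary axis and so the characteristic function. -/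
lemma map_eq_of_mgf_eq {Ω Ω' : Type*} [MeasurableSpace Ω] [MeasurableSpace Ω']
    {μ : Measure Ω} {ν : Measure Ω'} [IsProbabilityMeasure μ] [IsProbabilityMeasure ν]
    {X : Ω → ℝ} {Y : Ω' → ℝ} (hX : AEMeasurable X μ) (hY : AEMeasurable Y ν)
    (h : mgf X μ = mgf Y ν) (h0 : 0 ∈ interior (integrableExpSet X μ)) :
    μ.map X = ν.map Y := by
  have := Measure.isProbabilityMeasure_map hX
  have := Measure.isProbabilityMeasure_map hY
  refine Measure.ext_of_charFun (funext fun t => ?_)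
  rw [← complexMGF_mul_I hX, ← complexMGF_mul_I hY]
  exact eqOn_complexMGF_of_mgf h (by simpa using h0)

/-- The sum of squares of `m` independent `N(0, 1/m)` variables (a chi-squared variable divided by
its number `m` of degrees of freedom) has the Gamma law with shape and rate `m / 2`. -/
lemma hasLaw_sum_sq_gammaMeasure {Ω : Type*} [MeasurableSpace Ω] {μ : Measure Ω} {m : ℕ}
    (hm : 1 ≤ m) {X : Fin m → Ω → ℝ} (hX : ∀ i, HasLaw (X i) (gaussianReal 0 (1 / (m : NNReal))) μ)
    (hind : iIndepFun X μ) :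
    HasLaw (fun ω => ∑ i, X i ω ^ 2) (gammaMeasure (m / 2) (m / 2)) μ := by
  have := hind.isProbabilityMeasure
  have hm0 : (0 : ℝ) < m := by exact_mod_cast hm
  have ha : (0 : ℝ) < m / 2 := by positivity
  have := isProbabilityMeasure_gammaMeasure ha ha
  have hmeas : ∀ i, AEMeasurable (X i) μ := fun i => (hX i).aemeasurable
  have hS : AEMeasurable (fun ω => ∑ i, X i ω ^ 2) μ :=
    Finset.aemeasurable_fun_sum _ fun i _ => (hmeas i).pow_const 2
  have hv : (1 / (m : NNReal)) ≠ 0 := by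
    have : (m : NNReal) ≠ 0 := by exact_mod_cast hm0.ne'
    positivity
  have hmgf : mgf (fun ω => ∑ i, X i ω ^ 2) μ = mgf id (gammaMeasure (m / 2) (m / 2)) := by
    funext t
    have h1 : mgf (fun ω => ∑ i, X i ω ^ 2) μ t
        = ((√(2 * Real.pi * (1 / (m : NNReal) : NNReal)))⁻¹ *
          √(Real.pi / ((2 * ((1 / (m : NNReal) : NNReal) : ℝ))⁻¹ - t))) ^ m := by
      have h2 := (hind.comp (fun _ x => x ^ 2) (fun _ => by fun_prop)).mgf_sum₀ (t := t)
        (fun i => (hmeas i).pow_const 2) Finset.univ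
      have h3 : (∑ i, (fun x : ℝ => x ^ 2) ∘ X i) = fun ω => ∑ i, X i ω ^ 2 := by
        ext ω; simp
      rw [h3] at h2
      rw [h2, Finset.prod_congr rfl (g := fun _ => (√(2 * Real.pi * (1 / (m : NNReal) : NNReal)))⁻¹ *
          √(Real.pi / ((2 * ((1 / (m : NNReal) : NNReal) : ℝ))⁻¹ - t)))]
      · simp
      · intro i _
        rw [← mgf_sq_gaussianReal hv, ← (hX i).map_eq, mgf_map (hmeas i) (by fun_prop)]
    rw [h1]
    have h4 : (2 * ((1 / (m : NNReal) : NNReal) : ℝ))⁻¹ = m / 2 := by push_cast; field_simp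
    rw [h4]
    rcases lt_or_ge t (m / 2) with ht | ht
    · rw [mgf_gammaMeasure ha ha ht]
      have h5 : 0 < (m : ℝ) / 2 - t := sub_pos.2 ht
      rw [← Real.sqrt_inv, ← Real.sqrt_mul (by positivity), Real.sqrt_eq_rpow, ← Real.rpow_natCast,
        ← Real.rpow_mul (by positivity)]
      congr 1
      · push_cast
        field_simp
      · ring
    · rw [mgf_gammaMeasure_of_le ha ha ht, Real.sqrt_eq_zero_of_nonpos (x := Real.pi / _)
        (div_nonpos_of_nonneg_of_nonpos Real.pi_pos.le (by linarith))]
      simp; omega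
  refine ⟨hS, ?_⟩
  rw [map_eq_of_mgf_eq hS aemeasurable_id hmgf, Measure.map_id]
  rw [integrableExpSet_eq_of_mgf hmgf, mem_interior]
  exact ⟨Set.Iio (m / 2), fun t ht => integrable_exp_mul_gammaMeasure ha ha ht, isOpen_Iio, ha⟩

/-! ### Independence of rows -/

/-- The rows of a matrix of independent entries are independent. -/
lemma iIndepFun_rows {Ω ι κ : Type*} [MeasurableSpace Ω] [Countable ι] [Countable κ]
    {μ : Measure Ω} {X : ι × κ → Ω → ℝ} (hX : ∀ q, AEMeasurable (X q) μ) (h : iIndepFun X μ) :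
    iIndepFun (fun i ω (j : κ) => X (i, j) ω) μ := by
  have := h.isProbabilityMeasure
  have hp : ∀ q, IsProbabilityMeasure (μ.map (X q)) := fun q =>
    Measure.isProbabilityMeasure_map (hX q)
  have hrow : ∀ i, μ.map (fun ω (j : κ) => X (i, j) ω) =
      Measure.infinitePi fun j => μ.map (X (i, j)) := fun i =>
    (h.precomp (Prod.mk_right_injective i)).map_fun_eq_infinitePi_map₀' fun j => hX (i, j)
  rw [iIndepFun_iff_map_fun_eq_infinitePi_map₀' fun i => aemeasurable_pi_iff.2 fun j => hX (i, j)]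
  simp only [hrow]
  rw [← Measure.infinitePi_map_curry (fun i j => μ.map (X (i, j))),
    ← h.map_fun_eq_infinitePi_map₀' hX, AEMeasurable.map_map_of_aemeasurable
      (MeasurableEquiv.measurable _).aemeasurable (aemeasurable_pi_iff.2 hX)]
  rfl

/-! ### Tail bounds for the Gamma law -/

/-- Chernoff bound for the Gamma law with mean `1`; `gammaMeasure_le_le_exp` is its lower-tail
counterpart with the same rate function. -/
lemma gammaMeasure_ge_le_exp {a u : ℝ} (ha : 0 < a) (hu : 1 ≤ u) :
    (gammaMeasure a a).real {x | u ≤ x} ≤ Real.exp (-(a * (u - 1 - Real.log u))) := by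
  have := isProbabilityMeasure_gammaMeasure ha ha
  have hu0 : 0 < u := by linarith
  -- the optimal exponent in the Chernoff bound
  set t := a - a / u with ht
  have ht0 : 0 ≤ t := sub_nonneg.2 (div_le_self ha.le hu)
  have hta : t < a := sub_lt_self _ (by positivity)
  refine (measure_ge_le_exp_mul_mgf (X := id) u ht0
    (integrable_exp_mul_gammaMeasure ha ha hta)).trans_eq ?_
  rw [mgf_gammaMeasure ha ha hta, show a / (a - t) = u by rw [ht]; field_simp; ring,
    Real.rpow_def_of_pos hu0, ← Real.exp_add]
  congr 1
  rw [ht]; field_simp; ring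

lemma gammaMeasure_le_le_exp {a u : ℝ} (ha : 0 < a) (hu0 : 0 < u) (hu : u ≤ 1) :
    (gammaMeasure a a).real {x | x ≤ u} ≤ Real.exp (-(a * (u - 1 - Real.log u))) := by
  have := isProbabilityMeasure_gammaMeasure ha ha
  set t := a - a / u with ht
  have ht0 : t ≤ 0 := sub_nonpos.2 ((le_div_iff₀ hu0).2 (by nlinarith))
  have hta : t < a := sub_lt_self _ (by positivity)
  refine (measure_le_le_exp_mul_mgf (X := id) u ht0
    (integrable_exp_mul_gammaMeasure ha ha hta)).trans_eq ?_
  rw [mgf_gammaMeasure ha ha hta, show a / (a - t) = u by rw [ht]; field_simp; ring,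
    Real.rpow_def_of_pos hu0, ← Real.exp_add]
  congr 1
  rw [ht]; field_simp; ring

/-- This is `y ≤ sinh y` at `y = log (1 + δ)`. -/
lemma sq_div_le_sub_log_one_add {δ : ℝ} (hδ : 0 ≤ δ) :
    δ ^ 2 / (2 * (1 + δ)) ≤ δ - Real.log (1 + δ) := by
  have h0 : 0 < 1 + δ := by linarith
  have h := Real.self_le_sinh_iff.2 (Real.log_nonneg (by linarith : 1 ≤ 1 + δ))
  rw [Real.sinh_eq, Real.exp_neg, Real.exp_log h0] at h
  have h2 : δ ^ 2 / (2 * (1 + δ)) = δ - ((1 + δ) - (1 + δ)⁻¹) / 2 := by field_simp; ring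
  linarith

lemma sq_div_le_neg_sub_log_one_sub {δ : ℝ} (hδ : 0 ≤ δ) (hδ1 : δ < 1) :
    δ ^ 2 / (2 * (1 + δ)) ≤ -δ - Real.log (1 - δ) := by
  have h0 : 0 < 1 - δ := by linarith
  have h := Real.le_log_one_add_of_nonneg (x := δ / (1 - δ)) (by positivity)
  have h1 : 1 + δ / (1 - δ) = (1 - δ)⁻¹ := by field_simp; ring
  have h2 : 2 * (δ / (1 - δ)) / (δ / (1 - δ) + 2) = 2 * δ / (2 - δ) := by
    have : 2 - δ ≠ 0 := by linarith
    have : δ / (1 - δ) + 2 = (2 - δ) / (1 - δ) := by field_simp; ring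
    rw [this]; field_simp
  rw [h1, h2, Real.log_inv] at h
  have h3 : δ ^ 2 / (2 * (1 + δ)) ≤ δ ^ 2 / (2 - δ) :=
    div_le_div_of_nonneg_left (by positivity) (by linarith) (by linarith)
  have h4 : 2 * δ / (2 - δ) = δ + δ ^ 2 / (2 - δ) := by
    have : 2 - δ ≠ 0 := by linarith
    field_simp; ring
  linarith

lemma gammaMeasure_Iio_zero (a r : ℝ) : gammaMeasure a r (Set.Iio 0) = 0 := by
  rw [gammaMeasure, withDensity_apply _ measurableSet_Iio]
  exact lintegral_gammaPDF_of_nonpos le_rfl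

lemma gammaMeasure_abs_sub_one_gt_le {a δ : ℝ} (ha : 0 < a) (hδ : 0 ≤ δ) :
    (gammaMeasure a a).real {x | δ < |x - 1|} ≤
      2 * Real.exp (-(a * (δ ^ 2 / (2 * (1 + δ))))) := by
  have := isProbabilityMeasure_gammaMeasure ha ha
  have hup : (gammaMeasure a a).real {x | 1 + δ ≤ x} ≤
      Real.exp (-(a * (δ ^ 2 / (2 * (1 + δ))))) := by
    refine (gammaMeasure_ge_le_exp ha (by linarith)).trans (Real.exp_le_exp.2 ?_)
    have := sq_div_le_sub_log_one_add hδ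
    exact neg_le_neg (mul_le_mul_of_nonneg_left (by linarith) ha.le)
  have hlow : (gammaMeasure a a).real {x | x < 1 - δ} ≤
      Real.exp (-(a * (δ ^ 2 / (2 * (1 + δ))))) := by
    rcases lt_or_ge δ 1 with h | h
    · refine (measureReal_mono fun x hx => ?_).trans
        ((gammaMeasure_le_le_exp ha (u := 1 - δ) (by linarith) (by linarith)).trans
        (Real.exp_le_exp.2 ?_))
      · exact le_of_lt (show x < 1 - δ from hx)
      have := sq_div_le_neg_sub_log_one_sub hδ h
      exact neg_le_neg (mul_le_mul_of_nonneg_left (by linarith) ha.le)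
    -- for `1 ≤ δ` the lower tail lies in the null half-line
    · refine (measureReal_mono (s₂ := Set.Iio 0) fun x hx => ?_).trans ?_
      · have hx : x < 1 - δ := hx
        exact hx.trans_le (by linarith)
      · rw [measureReal_def, gammaMeasure_Iio_zero]; simp [Real.exp_nonneg]
  calc _ ≤ (gammaMeasure a a).real ({x | 1 + δ ≤ x} ∪ {x | x < 1 - δ}) := by
        refine measureReal_mono fun x hx => ?_
        rcases lt_abs.1 (show δ < |x - 1| from hx) with h | h
        · exact Or.inl (show 1 + δ ≤ x by linarith)
        · exact Or.inr (show x < 1 - δ by linarith)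
    _ ≤ _ := (measureReal_union_le _ _).trans (by linarith)

/-! ### Small-ball estimate for the Gamma law -/

/-- In the coordinate `y = log x` the Gamma law of shape and rate `a` has density proportional to
`exp (-a * (exp y - y))`, which is largest at `y = 0`. -/
lemma gammaMeasure_Icc_exp_eq_integral {a b : ℝ} (ha : 0 < a) (hb : 0 ≤ b) :
    (gammaMeasure a a).real (Set.Icc (Real.exp (-b)) (Real.exp b)) =
      ∫ y in (-b)..b, a ^ a / Real.Gamma a * Real.exp (-(a * (Real.exp y - y))) := by
  have hle : Real.exp (-b) ≤ Real.exp b := Real.exp_le_exp.2 (by linarith)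
  rw [gammaMeasure, measureReal_def, withDensity_apply _ measurableSet_Icc]
  have h1 : (∫⁻ x in Set.Icc (Real.exp (-b)) (Real.exp b), gammaPDF a a x).toReal =
      ∫ x in Set.Icc (Real.exp (-b)) (Real.exp b), gammaPDFReal a a x :=
    (integral_eq_lintegral_of_nonneg_ae (ae_of_all _ fun x => gammaPDFReal_nonneg ha ha x)
      (measurable_gammaPDFReal a a).aestronglyMeasurable).symm
  have h2 : ∫ x in Set.Icc (Real.exp (-b)) (Real.exp b), gammaPDFReal a a x =
      ∫ x in (Real.exp (-b))..(Real.exp b), gammaPDFReal a a x := by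
    rw [intervalIntegral.integral_of_le hle, integral_Icc_eq_integral_Ioc]
  rw [h1, h2]
  have hcont : ContinuousOn (gammaPDFReal a a) (Set.Ioi 0) := by
    have : ContinuousOn (fun x : ℝ => a ^ a / Real.Gamma a * x ^ (a - 1) * Real.exp (-(a * x)))
        (Set.Ioi 0) := by
      refine ContinuousOn.mul (ContinuousOn.mul continuousOn_const ?_) (by fun_prop)
      exact continuousOn_id.rpow_const fun x hx => Or.inl (ne_of_gt hx)
    refine this.congr fun x hx => ?_
    rw [gammaPDFReal, if_pos (le_of_lt hx)]
  rw [← intervalIntegral.integral_comp_mul_deriv' (f := Real.exp) (f' := Real.exp)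
    (fun x _ => Real.hasDerivAt_exp x) Real.continuous_exp.continuousOn
    (hcont.mono (by rintro _ ⟨y, -, rfl⟩; exact Real.exp_pos y))]
  refine intervalIntegral.integral_congr fun y _ => ?_
  simp only [Function.comp, gammaPDFReal, if_pos (Real.exp_pos y).le]
  rw [← Real.exp_mul, mul_assoc, mul_assoc, ← Real.exp_add, ← Real.exp_add]
  congr 2
  ring

/-- Shrinking a window around the mode of a unimodal law (in the coordinate `log x`) by a factor
`b / B` shrinks its mass by at most this factor. -/
lemma div_mul_gammaMeasure_Icc_exp_le {a b B : ℝ} (ha : 0 < a) (hb : 0 < b) (hB : b ≤ B) :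
    b / B * (gammaMeasure a a).real (Set.Icc (Real.exp (-B)) (Real.exp B)) ≤
      (gammaMeasure a a).real (Set.Icc (Real.exp (-b)) (Real.exp b)) := by
  have hB0 : 0 < B := hb.trans_le hB
  rw [gammaMeasure_Icc_exp_eq_integral ha hb.le, gammaMeasure_Icc_exp_eq_integral ha hB0.le]
  set c := b / B with hc
  have hc0 : 0 < c := by positivity
  have hc1 : c ≤ 1 := (div_le_one hB0).2 hB
  have hcB : c * B = b := by rw [hc]; field_simp
  have hK : 0 ≤ a ^ a / Real.Gamma a := by have := Real.Gamma_pos_of_pos ha; positivity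
  rw [← hcB, ← mul_neg, ← intervalIntegral.mul_integral_comp_mul_left]
  refine mul_le_mul_of_nonneg_left ?_ hc0.le
  refine intervalIntegral.integral_mono (by linarith)
    (Continuous.intervalIntegrable (by fun_prop) _ _)
    (Continuous.intervalIntegrable (by fun_prop) _ _) fun y => ?_
  refine mul_le_mul_of_nonneg_left (Real.exp_le_exp.2 (neg_le_neg
    (mul_le_mul_of_nonneg_left ?_ ha.le))) hK
  -- `exp y - y` is convex with minimum `1` at `0`
  have h1 := convexOn_exp.2 (Set.mem_univ y) (Set.mem_univ 0) hc0.le (sub_nonneg.2 hc1) (by ring)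
  simp only [smul_eq_mul, mul_zero, add_zero, Real.exp_zero, mul_one] at h1
  have h2 := Real.add_one_le_exp y
  nlinarith

lemma one_sub_le_gammaMeasure_Icc_exp {a B : ℝ} (ha : 0 < a) (hB : 0 ≤ B) :
    1 - 2 * Real.exp (-(a * (Real.exp (-B) - 1 + B))) ≤
      (gammaMeasure a a).real (Set.Icc (Real.exp (-B)) (Real.exp B)) := by
  have := isProbabilityMeasure_gammaMeasure ha ha
  have hlow := gammaMeasure_le_le_exp ha (Real.exp_pos (-B))
    (Real.exp_le_one_iff.2 (by linarith))
  have hup := gammaMeasure_ge_le_exp ha (Real.one_le_exp hB)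
  rw [Real.log_exp, sub_neg_eq_add] at hlow
  -- the rate function at `B` exceeds the one at `-B`, because `B ≤ sinh B`
  have hup' : (gammaMeasure a a).real {x | Real.exp B ≤ x} ≤
      Real.exp (-(a * (Real.exp (-B) - 1 + B))) := by
    refine hup.trans (Real.exp_le_exp.2 (neg_le_neg (mul_le_mul_of_nonneg_left ?_ ha.le)))
    rw [Real.log_exp]
    have := Real.self_le_sinh_iff.2 hB
    rw [Real.sinh_eq] at this
    linarith
  have hcover : (1 : ℝ) ≤ (gammaMeasure a a).real (Set.Icc (Real.exp (-B)) (Real.exp B)) +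
      ((gammaMeasure a a).real {x | x ≤ Real.exp (-B)} +
        (gammaMeasure a a).real {x | Real.exp B ≤ x}) := by
    refine le_trans ?_ ((measureReal_union_le _ _).trans
      (add_le_add_right (measureReal_union_le _ _) _))
    rw [show Set.Icc (Real.exp (-B)) (Real.exp B) ∪ ({x | x ≤ Real.exp (-B)} ∪
      {x | Real.exp B ≤ x}) = Set.univ from Set.eq_univ_of_forall fun x => ?_, probReal_univ]
    rcases le_total x (Real.exp (-B)) with h | h
    · exact Or.inr (Or.inl h)
    rcases le_total x (Real.exp B) with h' | h'
    · exact Or.inl ⟨h, h'⟩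
    · exact Or.inr (Or.inr h')
  linarith

lemma half_le_gammaMeasure_Icc_exp {a B : ℝ} (ha : 1 / 2 ≤ a) (hB : 0 < B) (haB : 32 ≤ a * B ^ 2) :
    1 / 2 ≤ (gammaMeasure a a).real (Set.Icc (Real.exp (-B)) (Real.exp B)) := by
  have ha0 : 0 < a := by linarith
  refine le_trans ?_ (one_sub_le_gammaMeasure_Icc_exp ha0 hB.le)
  -- the rate function is of order `B ^ 2` for `B ≤ 2` and of order `B` beyond
  have key : 2 ≤ a * (Real.exp (-B) - 1 + B) := by
    rcases le_total B 2 with h | h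
    · set x := Real.exp B - 1 with hx
      have hxB : B ≤ x := by have := Real.add_one_le_exp B; linarith
      have hx0 : 0 < x := by linarith
      have h1 := Real.le_log_one_add_of_nonneg hx0.le
      rw [show 1 + x = Real.exp B by rw [hx]; ring, Real.log_exp] at h1
      have h2 : Real.exp (-B) = (1 + x)⁻¹ := by
        rw [Real.exp_neg, hx]; congr 1; ring
      have h3 : B ^ 2 / 12 ≤ Real.exp (-B) - 1 + B := by
        calc B ^ 2 / 12 ≤ x ^ 2 / ((x + 2) * (1 + x)) := by
              rw [div_le_div_iff₀ (by norm_num) (by positivity)]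
              nlinarith [mul_nonneg hB.le hx0.le, mul_le_mul hxB hxB hB.le hx0.le,
                mul_nonneg (mul_nonneg hB.le hx0.le) (sub_nonneg.2 h),
                mul_nonneg (mul_nonneg hx0.le hx0.le) (sub_nonneg.2 h),
                mul_nonneg (mul_nonneg (mul_nonneg hx0.le hx0.le) (sub_nonneg.2 h)) hB.le,
                mul_nonneg (mul_nonneg (mul_nonneg hx0.le hB.le) (sub_nonneg.2 h)) hB.le]
          _ = (1 + x)⁻¹ - 1 + 2 * x / (x + 2) := by field_simp; ring
          _ ≤ _ := by rw [h2]; linarith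
      nlinarith
    · have h1 : 4 ≤ a * B := by nlinarith [mul_pos ha0 hB]
      have := Real.exp_pos (-B)
      nlinarith [mul_pos ha0 this]
  have h4 : (4 : ℝ) ≤ Real.exp (a * (Real.exp (-B) - 1 + B)) := by
    have h5 : (2 : ℝ) ≤ Real.exp 1 := by have := Real.add_one_le_exp 1; linarith
    calc (4 : ℝ) ≤ Real.exp 1 * Real.exp 1 := by nlinarith
      _ = Real.exp 2 := by rw [← Real.exp_add]; norm_num
      _ ≤ _ := Real.exp_le_exp.2 key
  rw [Real.exp_neg]
  have := inv_anti₀ (by norm_num) h4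
  linarith

/-- Small-ball estimate, uniform in `m`: a mean of `m` squared standard Gaussians puts mass of order
at least `t` on the window of radius `t / √m` around `1`, for bounded `t`. It is used with
`t = C * √ℓ`, where `ℓ = log (1 / ε)` dominates `1 - ε`. -/
lemma one_sub_le_gammaMeasure_abs_sub_one_le {m : ℕ} (hm : 1 ≤ m) {ε C : ℝ} (hε : 1 / 2 ≤ ε)
    (hε1 : ε < 1) (hC : 16 * Real.exp 8 ≤ C) :
    1 - ε ≤ (gammaMeasure (m / 2) (m / 2)).real
      {x | |x - 1| ≤ C * √(Real.log (1 / ε) / m)} := by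
  have hm1 : (1 : ℝ) ≤ m := by exact_mod_cast hm
  have hm0 : (0 : ℝ) < m := by linarith
  have ha : (0 : ℝ) < m / 2 := by positivity
  have := isProbabilityMeasure_gammaMeasure ha ha
  have hε0 : 0 < ε := by linarith
  have hC0 : 0 < C := lt_of_lt_of_le (by positivity) hC
  set ℓ := Real.log (1 / ε) with hℓ
  have hℓ0 : 0 < ℓ := Real.log_pos ((one_lt_div hε0).2 hε1)
  have hℓ1 : ℓ ≤ 1 := by
    have := Real.log_le_sub_one_of_pos (x := 1 / ε) (by positivity)
    have h2 : 1 / ε ≤ 2 := by rw [div_le_iff₀ hε0]; linarith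
    linarith
  have hεℓ : 1 - ε ≤ ℓ := by
    have := Real.log_le_sub_one_of_pos hε0
    rw [hℓ, one_div, Real.log_inv]; linarith
  set δ := C * √(ℓ / m) with hδ
  have hsm : 0 < √(m : ℝ) := Real.sqrt_pos.2 hm0
  have hδ' : δ = C * √ℓ / √m := by rw [hδ, Real.sqrt_div hℓ0.le]; ring
  have hδ0 : 0 < δ := by have := Real.sqrt_pos.2 hℓ0; rw [hδ']; positivity
  set B := 8 / √(m : ℝ) with hBdef
  have hB0 : 0 < B := by positivity
  have hBm : 1 / 2 ≤
      (gammaMeasure (m / 2) (m / 2)).real (Set.Icc (Real.exp (-B)) (Real.exp B)) := by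
    refine half_le_gammaMeasure_Icc_exp (by linarith) hB0 ?_
    rw [hBdef, div_pow, Real.sq_sqrt hm0.le]
    field_simp; norm_num
  -- `|log x| ≤ b` implies `|x - 1| ≤ δ`
  set b := Real.log (1 + δ) with hb
  have hb0 : 0 < b := Real.log_pos (by linarith)
  have hexp : Real.exp b = 1 + δ := Real.exp_log (by linarith)
  have hsub : Set.Icc (Real.exp (-b)) (Real.exp b) ⊆ {x | |x - 1| ≤ δ} := by
    rintro x ⟨hx1, hx2⟩
    rw [Real.exp_neg, hexp] at hx1
    rw [hexp] at hx2
    have : 1 - δ ≤ (1 + δ)⁻¹ := by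
      rw [← one_div, le_div_iff₀ (by linarith)]; nlinarith
    show |x - 1| ≤ δ
    exact abs_le.2 ⟨by linarith, by linarith⟩
  refine le_trans ?_ (measureReal_mono hsub)
  rcases le_total B b with hBb | hbB
  · refine le_trans (by linarith) (hBm.trans (measureReal_mono (Set.Icc_subset_Icc ?_ ?_)))
    · exact Real.exp_le_exp.2 (by linarith)
    · exact Real.exp_le_exp.2 hBb
  · refine le_trans ?_ (div_mul_gammaMeasure_Icc_exp_le ha hb0 hbB)
    have hB8 : B ≤ 8 := div_le_self (by norm_num) (Real.one_le_sqrt.2 hm1)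
    have h8 : 1 + δ ≤ Real.exp 8 := by rw [← hexp]; exact Real.exp_le_exp.2 (hbB.trans hB8)
    have hbδ : δ / Real.exp 8 ≤ b := by
      have h1 : 1 - (1 + δ)⁻¹ ≤ b := Real.one_sub_inv_le_log_of_pos (by linarith)
      have h2 : δ / Real.exp 8 ≤ δ / (1 + δ) :=
        div_le_div_of_nonneg_left hδ0.le (by linarith) h8
      have h3 : δ / (1 + δ) = 1 - (1 + δ)⁻¹ := by field_simp; ring
      linarith
    have hsq : ℓ ≤ √ℓ := Real.le_sqrt_of_sq_le (by nlinarith)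
    calc 1 - ε ≤ √ℓ := hεℓ.trans hsq
      _ ≤ C * √ℓ / (16 * Real.exp 8) := by
          rw [le_div_iff₀ (by positivity), mul_comm]
          exact mul_le_mul_of_nonneg_right hC (Real.sqrt_nonneg _)
      _ = δ / Real.exp 8 / B * (1 / 2) := by rw [hδ', hBdef]; field_simp; norm_num
      _ ≤ b / B * (1 / 2) := by gcongr
      _ ≤ _ := mul_le_mul_of_nonneg_left hBm (by positivity)

/-! ### From the Gram matrix to sums of squares -/

lemma norm_mulVec_le_of_isSparse {p s : ℕ} {A : Matrix (Fin p) (Fin p) ℝ} {δ : ℝ}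
    (hδ : 0 ≤ δ) (hA : ∀ j k, |A j k| ≤ δ) {x : Fin p → ℝ} (hx : IsSparse s x) :
    ‖A *ᵥ x‖ ≤ s * δ * ‖x‖ := by
  refine (pi_norm_le_iff_of_nonneg (by positivity)).2 fun j => ?_
  have h1 : (A *ᵥ x) j = ∑ k ∈ Finset.univ.filter (fun k => x k ≠ 0), A j k * x k := by
    rw [Matrix.mulVec, dotProduct, Finset.sum_filter]
    refine Finset.sum_congr rfl fun k _ => ?_
    split_ifs with h
    · rfl
    · rw [not_not.1 h, mul_zero]
  rw [h1]
  refine (norm_sum_le_of_le _ (f := fun k => A j k * x k) (n := fun _ => δ * ‖x‖)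
    fun k _ => ?_).trans ?_
  · rw [norm_mul]
    exact mul_le_mul (hA j k) (norm_le_pi_norm x k) (norm_nonneg _) hδ
  · rw [Finset.sum_const, nsmul_eq_mul, ← mul_assoc]
    have : ((Finset.univ.filter fun k => x k ≠ 0).card : ℝ) ≤ s := by exact_mod_cast hx
    gcongr

/-- The unit-norm linear forms on rows through which the entries of the Gram matrix are controlled:
the coordinates `v j` for the diagonal, and `(v j ± v k) / √2` for the off-diagonal entries, with
the sign chosen by the order of `j` and `k` so that each unordered pair gives one form of each
sign. -/
noncomputable def polarForm {p : ℕ} (j k : Fin p) (v : Fin p → ℝ) : ℝ :=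
  if j = k then v j else if j < k then (√2)⁻¹ * (v j + v k) else (√2)⁻¹ * (v j + -v k)

lemma measurable_polarForm {p : ℕ} (j k : Fin p) : Measurable (polarForm j k) := by
  unfold polarForm
  split_ifs <;> fun_prop

/-- Polarization: the Gram matrix is close to the identity entrywise as soon as the squared norms
of all the forms `polarForm j k` along the rows are close to `1`. -/
lemma abs_one_sub_transpose_mul_self_le {m p : ℕ} {M : Matrix (Fin m) (Fin p) ℝ} {δ : ℝ}
    (h : ∀ j k, |∑ i, polarForm j k (M i) ^ 2 - 1| ≤ δ) (j k : Fin p) :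
    |(1 - Mᵀ * M : Matrix (Fin p) (Fin p) ℝ) j k| ≤ δ := by
  have hgram : ∀ j k, (Mᵀ * M) j k = ∑ i, M i j * M i k := fun j k => by
    simp [Matrix.mul_apply]
  have hlt : ∀ j k, j < k → |(1 - Mᵀ * M : Matrix (Fin p) (Fin p) ℝ) j k| ≤ δ := by
    intro j k hjk
    have h1 := h j k
    have h2 := h k j
    have hsq : ((√2)⁻¹ : ℝ) ^ 2 = 1 / 2 := by rw [inv_pow, Real.sq_sqrt (by norm_num)]; norm_num
    simp only [polarForm, if_neg hjk.ne, if_pos hjk, if_neg hjk.ne', if_neg hjk.not_gt] at h1 h2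
    have h3 : (∑ i, ((√2)⁻¹ * (M i j + M i k)) ^ 2) - ∑ i, ((√2)⁻¹ * (M i k + -M i j)) ^ 2
        = 2 * ∑ i, M i j * M i k := by
      rw [← Finset.sum_sub_distrib, Finset.mul_sum]
      refine Finset.sum_congr rfl fun i _ => ?_
      rw [mul_pow, mul_pow, hsq]; ring
    rw [Matrix.sub_apply, Matrix.one_apply_ne hjk.ne, hgram]
    rw [abs_le] at h1 h2 ⊢
    constructor <;> linarith
  rcases lt_trichotomy j k with hjk | rfl | hjk
  · exact hlt j k hjk
  · have h1 := h j j
    simp only [polarForm, if_true] at h1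
    rw [Matrix.sub_apply, Matrix.one_apply_eq, hgram, abs_sub_comm]
    simpa only [sq] using h1
  · have h1 := hlt k j hjk
    rw [Matrix.sub_apply, Matrix.one_apply_ne hjk.ne, hgram] at h1
    rw [Matrix.sub_apply, Matrix.one_apply_ne hjk.ne', hgram]
    simpa only [mul_comm] using h1

/-! ### Gaussian matrices -/

lemma hasLaw_inv_sqrt_two_mul_add {Ω : Type*} [MeasurableSpace Ω] {μ : Measure Ω} {v : NNReal}
    {X Y : Ω → ℝ} (hX : HasLaw X (gaussianReal 0 v) μ) (hY : HasLaw Y (gaussianReal 0 v) μ)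
    (hXY : IndepFun X Y μ) :
    HasLaw (fun ω => (√2)⁻¹ * (X ω + Y ω)) (gaussianReal 0 v) μ := by
  have h1 : HasLaw (fun ω => X ω + Y ω) (gaussianReal (0 + 0) (v + v)) μ :=
    ⟨hX.aemeasurable.add hY.aemeasurable,
      gaussianReal_add_gaussianReal_of_indepFun hXY hX.map_eq hY.map_eq⟩
  have h2 := gaussianReal_const_mul h1 (√2)⁻¹
  convert h2 using 2
  · simp
  · ext
    push_cast
    rw [inv_pow, Real.sq_sqrt (by norm_num)]
    ring

namespace IsGaussianMatrix

variable {Ω : Type*} [MeasurableSpace Ω] {μ : Measure Ω} {m p : ℕ}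
  {H : Ω → Matrix (Fin m) (Fin p) ℝ}

lemma hasLaw_polarForm (hH : IsGaussianMatrix μ H) (j k : Fin p) (i : Fin m) :
    HasLaw (fun ω => polarForm j k (H ω i)) (gaussianReal 0 (1 / (m : NNReal))) μ := by
  unfold polarForm
  split_ifs with h1 h2
  · exact hH.hasLaw i j
  all_goals
    have hind : IndepFun (fun ω => H ω i j) (fun ω => H ω i k) μ :=
      hH.indep.indepFun (i := (i, j)) (j := (i, k)) (by simpa using h1)
  · exact hasLaw_inv_sqrt_two_mul_add (hH.hasLaw i j) (hH.hasLaw i k) hind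
  · refine hasLaw_inv_sqrt_two_mul_add (hH.hasLaw i j) ?_ (hind.comp measurable_id measurable_neg)
    simpa only [neg_zero] using! gaussianReal_neg (hH.hasLaw i k)

lemma iIndepFun_polarForm (hH : IsGaussianMatrix μ H) (j k : Fin p) :
    iIndepFun (fun (i : Fin m) ω => polarForm j k (H ω i)) μ :=
  (iIndepFun_rows (fun q => (hH.hasLaw q.1 q.2).aemeasurable) hH.indep).comp
    (fun _ => polarForm j k) fun _ => measurable_polarForm j k

lemma hasLaw_sum_polarForm_sq (hH : IsGaussianMatrix μ H) (hm : 1 ≤ m) (j k : Fin p) :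
    HasLaw (fun ω => ∑ i, polarForm j k (H ω i) ^ 2) (gammaMeasure (m / 2) (m / 2)) μ :=
  hasLaw_sum_sq_gammaMeasure hm (hH.hasLaw_polarForm j k) (hH.iIndepFun_polarForm j k)

/-- Union bound over the `p ^ 2` forms. -/
lemma one_sub_le_measureReal_forall_polarForm [IsProbabilityMeasure μ]
    (hH : IsGaussianMatrix μ H) (hm : 1 ≤ m) {δ : ℝ} (hδ : 0 ≤ δ) :
    1 - p ^ 2 * (2 * Real.exp (-(m / 2 * (δ ^ 2 / (2 * (1 + δ)))))) ≤
      μ.real {ω | ∀ j k, |∑ i, polarForm j k (H ω i) ^ 2 - 1| ≤ δ} := by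
  have ha : (0 : ℝ) < m / 2 := by
    have : (0 : ℝ) < m := by exact_mod_cast hm
    positivity
  have hbad : ∀ q : Fin p × Fin p,
      μ.real {ω | δ < |∑ i, polarForm q.1 q.2 (H ω i) ^ 2 - 1|} ≤
        2 * Real.exp (-(m / 2 * (δ ^ 2 / (2 * (1 + δ))))) := fun q => by
    rw [(hH.hasLaw_sum_polarForm_sq hm q.1 q.2).measureReal_eq (p := fun x => δ < |x - 1|)
      (measurableSet_lt measurable_const (by fun_prop))]
    exact gammaMeasure_abs_sub_one_gt_le ha hδ
  have hunion : μ.real (⋃ q : Fin p × Fin p,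
      {ω | δ < |∑ i, polarForm q.1 q.2 (H ω i) ^ 2 - 1|}) ≤
        p ^ 2 * (2 * Real.exp (-(m / 2 * (δ ^ 2 / (2 * (1 + δ)))))) := by
    refine (measureReal_iUnion_fintype_le _).trans
      ((Finset.sum_le_sum fun q _ => hbad q).trans_eq ?_)
    simp [sq]
  have hcover : (1 : ℝ) ≤ μ.real {ω | ∀ j k, |∑ i, polarForm j k (H ω i) ^ 2 - 1| ≤ δ} +
      μ.real (⋃ q : Fin p × Fin p, {ω | δ < |∑ i, polarForm q.1 q.2 (H ω i) ^ 2 - 1|}) := by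
    refine le_trans (le_of_eq ?_) (measureReal_union_le _ _)
    refine (probReal_univ (μ := μ)).symm.trans (congrArg _ ?_)
    refine (Set.eq_univ_of_forall fun ω => ?_).symm
    by_cases h : ∀ j k, |∑ i, polarForm j k (H ω i) ^ 2 - 1| ≤ δ
    · exact Or.inl h
    · push Not at h
      obtain ⟨j, k, hjk⟩ := h
      exact Or.inr (Set.mem_iUnion.2 ⟨(j, k), hjk⟩)
  linarith

end IsGaussianMatrix

/-! ### The restricted norm bound -/

/-- In the regime `ℓ ≤ κ * m` the Chernoff exponent at deviation `C * √(ℓ / m)` is at least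
`4 * ℓ`, once `C` is large in terms of `κ`. -/
lemma four_mul_le_chernoff_exponent {κ C ℓ m : ℝ} (hm : 0 < m) (hℓ : 0 ≤ ℓ)
    (hreg : ℓ ≤ κ * m) (hC : 16 + 16 * √κ ≤ C) :
    4 * ℓ ≤ m / 2 * ((C * √(ℓ / m)) ^ 2 / (2 * (1 + C * √(ℓ / m)))) := by
  have hC0 : 0 < C := by have := Real.sqrt_nonneg κ; linarith
  have hs : √(ℓ / m) ≤ √κ := Real.sqrt_le_sqrt ((div_le_iff₀ hm).2 hreg)
  have hs0 := Real.sqrt_nonneg (ℓ / m)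
  have hC2 : 16 * (1 + C * √(ℓ / m)) ≤ C ^ 2 := by
    have := mul_le_mul_of_nonneg_left hs hC0.le
    nlinarith
  rw [mul_pow, Real.sq_sqrt (by positivity)]
  have h : m / 2 * (C ^ 2 * (ℓ / m) / (2 * (1 + C * √(ℓ / m)))) =
      C ^ 2 * ℓ / (4 * (1 + C * √(ℓ / m))) := by field_simp; ring
  rw [h, le_div_iff₀ (by positivity)]
  nlinarith

/-- The norm on `Fin p → ℝ` is the sup norm. The event is uniform in the sparse vector `x`. -/
theorem mainTheorem7 (κ : ℝ) (hκ : 0 < κ) :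
    ∃ C : ℝ, 0 < C ∧
      ∀ (Ω : Type*) [MeasurableSpace Ω] (μ : Measure Ω) [IsProbabilityMeasure μ]
        (m p s : ℕ) (_hm : 1 ≤ m) (_hp : 1 ≤ p)
        (H : Ω → Matrix (Fin m) (Fin p) ℝ) (_hH : IsGaussianMatrix μ H)
        (ε : ℝ) (_hε0 : 0 < ε) (_hε1 : ε < 1)
        (_hreg : Real.log ((p : ℝ) / ε) ≤ κ * (m : ℝ)),
        1 - ε ≤ μ.real {ω | ∀ x : Fin p → ℝ, IsSparse s x →
          ‖(1 - (H ω)ᵀ * H ω) *ᵥ x‖ ≤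
            (C * (s : ℝ) * Real.sqrt (Real.log ((p : ℝ) / ε) / (m : ℝ))) * ‖x‖} := by
  -- `16 * exp 8` serves the small-ball estimate, `16 * √κ` the Chernoff exponent
  refine ⟨16 * Real.exp 8 + 16 * √κ, by positivity, ?_⟩
  intro Ω _ μ _ m p s hm hp H hH ε hε0 hε1 hreg
  set C := 16 * Real.exp 8 + 16 * √κ with hC
  have hm0 : (0 : ℝ) < m := by exact_mod_cast hm
  have hp1 : (1 : ℝ) ≤ p := by exact_mod_cast hp
  have hC0 : 0 < C := by positivity
  set ℓ := Real.log (p / ε) with hℓ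
  set δ := C * √(ℓ / m) with hδ
  have hδ0 : 0 ≤ δ := by positivity
  refine le_trans ?_ (measureReal_mono
    (s₁ := {ω | ∀ j k, |∑ i, polarForm j k (H ω i) ^ 2 - 1| ≤ δ}) fun ω hω x hx => ?_)
  · rcases le_or_gt (ε / p) (1 / 2) with hsmall | hlarge
    · refine le_trans ?_ (hH.one_sub_le_measureReal_forall_polarForm hm hδ0)
      have hℓ0 : 0 ≤ ℓ := Real.log_nonneg ((one_le_div hε0).2 (by linarith))
      have hexp := four_mul_le_chernoff_exponent hm0 hℓ0 hreg (C := C) (by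
        have := Real.one_le_exp (x := 8) (by norm_num); linarith)
      have h1 : Real.exp (-(m / 2 * (δ ^ 2 / (2 * (1 + δ))))) ≤ (ε / p) ^ 4 := by
        refine (Real.exp_le_exp.2 (neg_le_neg hexp)).trans_eq ?_
        have h2 : Real.exp (-ℓ) = ε / p := by
          rw [Real.exp_neg, hℓ, Real.exp_log (by positivity), inv_div]
        rw [← h2, ← Real.exp_nat_mul]; congr 1; push_cast; ring
      have h3 : p ^ 2 * (2 * (ε / p) ^ 4) ≤ ε := by
        have h0 : 0 ≤ ε / p := by positivity
        calc (p : ℝ) ^ 2 * (2 * (ε / p) ^ 4) = 2 * (ε / p) ^ 2 * ε ^ 2 := by field_simp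
          _ ≤ 2 * (1 / 2) ^ 2 * ε ^ 2 := by gcongr
          _ ≤ ε := by nlinarith
      have h4 := mul_le_mul_of_nonneg_left h1 (by positivity : (0 : ℝ) ≤ p ^ 2 * 2)
      linarith
    · -- only `p = 1` remains, where `ε` may be close to `1` and `δ * √m` close to `0`
      have hp' : p = 1 := by
        rw [lt_div_iff₀ (by linarith)] at hlarge
        have : (p : ℝ) < 2 := by linarith
        have : p < 2 := by exact_mod_cast this
        omega
      subst hp'
      rw [Nat.cast_one, div_one] at hlarge
      have h1 := one_sub_le_gammaMeasure_abs_sub_one_le hm hlarge.le hε1 (C := C) (by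
        have := Real.sqrt_nonneg κ; linarith)
      rw [← (hH.hasLaw_sum_polarForm_sq hm 0 0).measureReal_eq (p := fun x => |x - 1| ≤ _)
        (measurableSet_le (by fun_prop) measurable_const)] at h1
      refine h1.trans (measureReal_mono fun ω hω j k => ?_)
      rw [Subsingleton.elim j 0, Subsingleton.elim k 0, hδ, hℓ, Nat.cast_one]
      exact hω
  · refine (norm_mulVec_le_of_isSparse hδ0
      (abs_one_sub_transpose_mul_self_le hω) hx).trans_eq ?_
    rw [hδ]; ring
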